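/- Let $\gamma>0$ and let $\Theta=\ell^2$ be the space of real sequences $\theta=(\theta_1,\theta_2,\dots)$ with $\|\theta\|_2=(\sum_i\theta_i^2)^{1/2}<\infty$; write $\theta_{(n)}=(\theta_1,\dots,\theta_n)$. For each $n$ let $\Sigma_{(n)}$ be a known positive definite $n\times n$ matrix, and let $p^{(n)}_{\theta}$ be the density of $N(\theta_{(n)},\Sigma_{(n)})$ on $\mathbb R^n$. Assume: (a) there are constants $a_1,a_2>0$ such that $a_1 n\sum_{i=1}^n\alpha_i^2\le \alpha\Sigma_{(n)}^{-1}\alpha^T\le a_2 n\sum_{i=1}^n\alpha_i^2$ for all $n$ and all $\alpha\in\mathbb R^n$; (b) $\theta_0\in\Theta$ satisfies $\sum_{i=1}^\infty\theta_{0,i}^2\,i^{2\gamma}<\infty$. Then there is a constant $c>0$ such that, with $k=k_n=\lfloor c\,n^{1/(2\gamma+1)}\rfloor$, the following holds. Let $\Sigma_k$ be positive definite $k\times k$ matrices such that (c) for some constant $C>0$, $\alpha\Sigma_k^{-1}\alpha^T\le C\,k\sum_{i=1}^k\alpha_i^2\,i^{2\gamma}$ for all $k=k_n$ ($n\ge 1$)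 and all $\alpha\in\mathbb R^k$, and let the prior $\Pi_n$ on $\Theta$ be the law of $\theta$ when $(\theta_1,\dots,\theta_k)\sim N(0,\Sigma_k)$ and $\theta_i=0$ for $i>k$. Then there is a constant $r>0$ such that, whenever $X^{(n)}\sim N(\theta_{0,(n)},\Sigma_{(n)})$, $n=1,2,\dots$, are random vectors on a common probability space (with any joint distribution, for instance independent), the posterior distributions $$\Pi_n(B\mid X^{(n)})=\frac{\int_B p_\theta^{(n)}(X^{(n)})\,\Pi_n(d\theta)}{\int_\Theta p_\theta^{(n)}(X^{(n)})\,\Pi_n(d\theta)}$$ satisfy, with $\varepsilon_n=n^{-\gamma/(2\gamma+1)}$, $$\Pi_n\bigl(\theta\in\Theta:\ \|\theta-\theta_0\|_2\ge r\,\varepsilon_n\mid X^{(n)}\bigr)\longrightarrow 0\quad\text{almost surely as } n\to\infty.$$ -/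

import Mathlib

open MeasureTheory ProbabilityTheory Filter Topology Matrix
open scoped ENNReal

namespace InfNormal

noncomputable section

/-- The parameter space `Θ = ℓ²` of square-summable real sequences. The coordinate of index
`i : ℕ` is the `(i + 1)`-st coordinate in one-based numbering. -/
abbrev Param : Type := lp (fun _ : ℕ => ℝ) 2

/-- `Θ` carries its Borel σ-algebra. -/
instance instMeasurableSpaceParam : MeasurableSpace Param := borel Param

instance instBorelSpaceParam : BorelSpace Param := ⟨rfl⟩

/-- The vector `θ_(n)` of the first `n` coordinates of `θ`. -/
def trunc (n : ℕ) (θ : Param) : EuclideanSpace ℝ (Fin n) :=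
  WithLp.toLp 2 (fun i : Fin n => θ (i : ℕ))

/-- The embedding of `ℝᵏ` in `Θ` that pads a vector with zeros. -/
def pad (k : ℕ) : EuclideanSpace ℝ (Fin k) →L[ℝ] Param :=
  ∑ i : Fin k, (lp.singleContinuousLinearMap ℝ (fun _ : ℕ => ℝ) 2 (i : ℕ)).comp
    (EuclideanSpace.proj i : EuclideanSpace ℝ (Fin k) →L[ℝ] ℝ)

/-- The quadratic form `α S⁻¹ αᵀ`. -/
def precForm {n : ℕ} (S : Matrix (Fin n) (Fin n) ℝ) (α : Fin n → ℝ) : ℝ :=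
  α ⬝ᵥ (S⁻¹ *ᵥ α)

/-- The Lebesgue density at `x` of the normal distribution `N(m, S)` on `ℝⁿ`, for positive
definite `S`. -/
def gaussDensity {n : ℕ} (m : EuclideanSpace ℝ (Fin n)) (S : Matrix (Fin n) (Fin n) ℝ)
    (x : EuclideanSpace ℝ (Fin n)) : ℝ :=
  (Real.sqrt ((2 * Real.pi) ^ n * S.det))⁻¹ * Real.exp (-(1 / 2) * precForm S (x - m).ofLp)

/-- The prior: the first `k` coordinates of `θ` have the law `N(0, S)`, the others are `0`. -/
def prior (k : ℕ) (S : Matrix (Fin k) (Fin k) ℝ) : Measure Param :=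
  (multivariateGaussian (0 : EuclideanSpace ℝ (Fin k)) S).map (pad k)

/-- The posterior mass of `B` given `x`, for the prior `Pr` and the observation `x` from the model
`N(θ_(n), S)`, `θ ∈ Θ`, by Bayes' formula. -/
def bayesPosterior {n : ℕ} (S : Matrix (Fin n) (Fin n) ℝ) (Pr : Measure Param)
    (x : EuclideanSpace ℝ (Fin n)) (B : Set Param) : ℝ≥0∞ :=
  (∫⁻ θ in B, ENNReal.ofReal (gaussDensity (trunc n θ) S x) ∂Pr) /
    (∫⁻ θ, ENNReal.ofReal (gaussDensity (trunc n θ) S x) ∂Pr)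

/-- The number `k = ⌊c n^{1/(2γ+1)}⌋` of coordinates on which the prior lives. -/
def priorDim (γ c : ℝ) (n : ℕ) : ℕ := ⌊(n : ℝ) ^ (1 / (2 * γ + 1)) * c⌋₊

/-- The rate `ε_n = n^{-γ/(2γ+1)}`. -/
def rate (γ : ℝ) (n : ℕ) : ℝ := (n : ℝ) ^ (-γ / (2 * γ + 1))

/-- Condition (a): `α Σ_(n)⁻¹ αᵀ ≈ n ∑ α_i²`, with constants independent of `n` and `α`. -/
def CondA (Sig : (n : ℕ) → Matrix (Fin n) (Fin n) ℝ) : Prop :=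
  ∃ a₁ > (0 : ℝ), ∃ a₂ > (0 : ℝ), ∀ (n : ℕ) (α : Fin n → ℝ),
    a₁ * (n * ∑ i, α i ^ 2) ≤ precForm (Sig n) α ∧
      precForm (Sig n) α ≤ a₂ * (n * ∑ i, α i ^ 2)

/-- Condition (b): `∑ θ_{0,i}² i^{2γ} < ∞`. -/
def CondB (γ : ℝ) (θ₀ : Param) : Prop :=
  Summable fun i : ℕ => θ₀ i ^ 2 * ((i : ℝ) + 1) ^ (2 * γ)

/-- Condition (c): `α Σ_k⁻¹ αᵀ ≲ k ∑ α_i² i^{2γ}`, with a constant independent of `k` and `α`,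
for all dimensions `k = ⌊c n^{1/(2γ+1)}⌋` that occur. -/
def CondC (γ c : ℝ) (S : (k : ℕ) → Matrix (Fin k) (Fin k) ℝ) : Prop :=
  ∃ C > (0 : ℝ), ∀ (n : ℕ) (α : Fin (priorDim γ c n) → ℝ),
    precForm (S (priorDim γ c n)) α ≤
      C * (priorDim γ c n * ∑ i, α i ^ 2 * ((i : ℕ) + 1 : ℝ) ^ (2 * γ))

end

end InfNormal

open InfNormal

/-! Everything is conjugate, so the posterior can be handled explicitly. Write θ = `pad` (S^{1/2} z)
with z standard Gaussian, and multiply the observation by Σ^{-1/2}. This gives y = G z₀ + b + w,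
with w standard Gaussian, z₀ the whitened truncation of θ₀ and b the truncation bias. The posterior
of z is Gaussian with density proportional to exp(-q(z - m)/2), where q(t) = ‖t‖² + ‖G t‖² and m = K
y is the ridge estimator.

Put x = n^{1/(2γ+1)}, so that n ε_n² = x and k ≤ x ≤ k + 1. Three errors, each O(√x) on the scale of
G, are controlled: the spread, since q ≥ 8x has posterior mass at most 2^{k/2} e^{-2x} ≤ e^{-x}
(`setLIntegral_posterior_le`); the bias, since m minimizes a penalized least squares criterion
(`norm_map_posteriorMean_sub_le`), where (b) and (c) give ‖z₀‖² = O(x) and (a) and (b) give ‖b‖² =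
O(x); the noise, which enters through a contraction T into k dimensions, so ‖T w‖² ≥ 8x has
probability at most e^{-x} (`stdGaussian_le_norm_sq_comp`). The lower bound in (a) turns √x on the
scale of G into ε_n for θ. The probabilities e^{-x} are summable in n, so Borel–Cantelli gives
almost sure convergence for any joint law. -/

namespace InfNormal

/-! ### Completing the square in the Gaussian linear model. -/

section LinearModel

variable {V W : Type*} [NormedAddCommGroup V] [InnerProductSpace ℝ V] [NormedAddCommGroup W]
  [InnerProductSpace ℝ W]

variable (V) in
/-- The density of the standard Gaussian measure. -/
noncomputable def stdDensity (x : V) : ℝ :=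
  ((2 * Real.pi) ^ ((Module.finrank ℝ V : ℝ) / 2))⁻¹ * Real.exp (-(1 / 2) * ‖x‖ ^ 2)

lemma stdDensity_nonneg (x : V) : 0 ≤ stdDensity V x := by
  unfold stdDensity; positivity

lemma continuous_stdDensity : Continuous (stdDensity V) := by
  unfold stdDensity; fun_prop

variable [FiniteDimensional ℝ V] [FiniteDimensional ℝ W]

/-- In the linear model `y = G z + noise` with a standard Gaussian prior on `z`, the normal
equation `m + G* G m = G* y` characterizes the posterior mean `m`. -/
lemma complete_square (G : V →L[ℝ] W) (y : W) (m : V)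
    (hm : m + G.adjoint (G m) = G.adjoint y) (z : V) :
    ‖z‖ ^ 2 + ‖y - G z‖ ^ 2 =
      ‖z - m‖ ^ 2 + ‖G (z - m)‖ ^ 2 + (‖m‖ ^ 2 + ‖y - G m‖ ^ 2) := by
  -- Pairing the normal equation with z - m makes the cross terms of the two expansions cancel.
  have h1 := congrArg (fun v => inner ℝ v (z - m)) hm
  simp only [inner_add_left, ContinuousLinearMap.adjoint_inner_left] at h1
  have e1 : ‖z‖ ^ 2 = ‖m‖ ^ 2 + 2 * inner ℝ m (z - m) + ‖z - m‖ ^ 2 := by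
    rw [← norm_add_sq_real]; congr 2; abel
  have e2 : ‖y - G z‖ ^ 2 =
      ‖y - G m‖ ^ 2 - 2 * inner ℝ (y - G m) (G (z - m)) + ‖G (z - m)‖ ^ 2 := by
    rw [← norm_sub_sq_real]; congr 2; rw [map_sub]; abel
  rw [e1, e2, inner_sub_left]
  linarith

end LinearModel

/-! ### Exponential moments and tails of Gaussian measures. -/

section StdGaussian

variable {V W : Type*} [NormedAddCommGroup V] [InnerProductSpace ℝ V] [FiniteDimensional ℝ V]
  [MeasurableSpace V] [BorelSpace V] [NormedAddCommGroup W] [InnerProductSpace ℝ W]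
  [FiniteDimensional ℝ W] [MeasurableSpace W] [BorelSpace W]

lemma integrable_stdDensity : Integrable (stdDensity V) := by
  unfold stdDensity
  refine Integrable.const_mul ?_ _
  have h := (GaussianFourier.integrable_cexp_neg_mul_sq_norm_add (V := V) (b := (1 / 2 : ℂ))
    (by norm_num) 0 0).norm
  refine h.congr (Eventually.of_forall fun x => ?_)
  simp only [Complex.norm_exp]
  congr 1
  simp [← Complex.ofReal_pow]

lemma stdGaussian_eq_withDensity :
    stdGaussian V = volume.withDensity (fun x => ENNReal.ofReal (stdDensity V x)) := by
  have hfin : IsFiniteMeasure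
      ((volume : Measure V).withDensity (fun x => ENNReal.ofReal (stdDensity V x))) :=
    isFiniteMeasure_withDensity_ofReal integrable_stdDensity.hasFiniteIntegral
  apply Measure.ext_of_charFun
  ext t
  rw [charFun_stdGaussian, charFun_apply,
    integral_withDensity_eq_integral_toReal_smul₀
      (continuous_stdDensity.measurable.ennreal_ofReal.aemeasurable) (by simp)]
  have h := GaussianFourier.integral_cexp_neg_mul_sq_norm_add (V := V) (b := (1 / 2 : ℂ))
    (by norm_num) Complex.I t
  have h2 : ∀ x : V, (ENNReal.ofReal (stdDensity V x)).toReal •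
      Complex.exp ((inner ℝ x t : ℝ) * Complex.I) =
      ((((2 * Real.pi) ^ ((Module.finrank ℝ V : ℝ) / 2))⁻¹ : ℝ) : ℂ) *
        Complex.exp (-(1 / 2) * ‖x‖ ^ 2 + Complex.I * (inner ℝ t x : ℝ)) := by
    intro x
    rw [ENNReal.toReal_ofReal (stdDensity_nonneg x), Complex.real_smul, stdDensity,
      Complex.ofReal_mul, mul_assoc, Complex.ofReal_exp, ← Complex.exp_add,
      real_inner_comm]
    push_cast
    congr 3
    ring
  simp_rw [h2]
  rw [integral_const_mul, h, ← mul_assoc]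
  have h3 : ((((2 * Real.pi) ^ ((Module.finrank ℝ V : ℝ) / 2))⁻¹ : ℝ) : ℂ) *
      ((Real.pi : ℂ) / (1 / 2)) ^ ((Module.finrank ℝ V : ℂ) / 2) = 1 := by
    have : ((Real.pi : ℂ) / (1 / 2)) = ((2 * Real.pi : ℝ) : ℂ) := by push_cast; ring
    rw [this]
    have e : ((Module.finrank ℝ V : ℂ) / 2) = (((Module.finrank ℝ V : ℝ) / 2 : ℝ) : ℂ) := by
      push_cast; ring
    rw [e, ← Complex.ofReal_cpow (by positivity), ← Complex.ofReal_mul, inv_mul_cancel₀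
      (by positivity), Complex.ofReal_one]
  rw [h3, one_mul]
  congr 1
  rw [Complex.I_sq]
  ring

lemma lintegral_stdGaussian {f : V → ℝ≥0∞} (hf : Measurable f) :
    ∫⁻ x, f x ∂(stdGaussian V) = ∫⁻ x, ENNReal.ofReal (stdDensity V x) * f x := by
  rw [stdGaussian_eq_withDensity, lintegral_withDensity_eq_lintegral_mul _
    continuous_stdDensity.measurable.ennreal_ofReal hf]
  rfl

lemma lintegral_eq_mul_lintegral_comp_sqrt_two_smul {f : V → ℝ≥0∞} (hf : Measurable f) :
    ∫⁻ x, f x = ENNReal.ofReal ((2 : ℝ) ^ ((Module.finrank ℝ V : ℝ) / 2)) *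
      ∫⁻ x, f (Real.sqrt 2 • x) := by
  have h2 : (0 : ℝ) < Real.sqrt 2 := by positivity
  rw [← lintegral_map (g := fun x : V => Real.sqrt 2 • x) hf (measurable_const_smul _),
    Measure.map_addHaar_smul _ h2.ne', lintegral_smul_measure, smul_eq_mul, ← mul_assoc,
    ← ENNReal.ofReal_mul (by positivity)]
  have : (2 : ℝ) ^ ((Module.finrank ℝ V : ℝ) / 2) *
      |(Real.sqrt 2 ^ (Module.finrank ℝ V))⁻¹| = 1 := by
    rw [abs_of_pos (by positivity), Real.sqrt_eq_rpow, ← Real.rpow_natCast, ← Real.rpow_mul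
      (by norm_num), one_div, mul_comm (2⁻¹ : ℝ), ← div_eq_mul_inv]
    exact mul_inv_cancel₀ (by positivity)
  rw [this, ENNReal.ofReal_one, one_mul]

lemma lintegral_exp_quarter_norm_sq_stdGaussian :
    ∫⁻ x, ENNReal.ofReal (Real.exp (‖x‖ ^ 2 / 4)) ∂(stdGaussian V) =
      ENNReal.ofReal ((2 : ℝ) ^ ((Module.finrank ℝ V : ℝ) / 2)) := by
  rw [lintegral_stdGaussian (by fun_prop),
    lintegral_eq_mul_lintegral_comp_sqrt_two_smul
      (by have := (continuous_stdDensity (V := V)).measurable; fun_prop)]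
  have h1 : ∫⁻ x, ENNReal.ofReal (stdDensity V x) = 1 := by
    have := measure_univ (μ := stdGaussian V)
    rwa [stdGaussian_eq_withDensity, withDensity_apply _ MeasurableSet.univ,
      setLIntegral_univ] at this
  have h2 : ∀ x : V, ENNReal.ofReal (stdDensity V (Real.sqrt 2 • x)) *
      ENNReal.ofReal (Real.exp (‖Real.sqrt 2 • x‖ ^ 2 / 4)) =
      ENNReal.ofReal (stdDensity V x) := by
    intro x
    rw [← ENNReal.ofReal_mul (stdDensity_nonneg _), stdDensity, stdDensity, mul_assoc,
      ← Real.exp_add, norm_smul, mul_pow, Real.norm_of_nonneg (by positivity),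
      Real.sq_sqrt (by norm_num)]
    congr 3
    ring
  simp_rw [h2]
  rw [h1, mul_one]

lemma lintegral_exp_inner_stdGaussian (a : V) :
    ∫⁻ x, ENNReal.ofReal (Real.exp (inner ℝ a x)) ∂(stdGaussian V) =
      ENNReal.ofReal (Real.exp (‖a‖ ^ 2 / 2)) := by
  have hmap := IsGaussian.map_eq_gaussianReal (μ := stdGaussian V) (innerSL ℝ a)
  rw [integral_strongDual_stdGaussian, variance_dual_stdGaussian, innerSL_apply_norm] at hmap
  have hm := congrFun (mgf_id_gaussianReal (μ := 0) (v := (‖a‖ ^ 2).toNNReal)) 1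
  have hi := integrable_exp_mul_gaussianReal (μ := 0) (v := (‖a‖ ^ 2).toNNReal) 1
  calc ∫⁻ x, ENNReal.ofReal (Real.exp (inner ℝ a x)) ∂(stdGaussian V)
      = ∫⁻ y, ENNReal.ofReal (Real.exp y) ∂((stdGaussian V).map (innerSL ℝ a)) := by
        rw [lintegral_map (by fun_prop) (by fun_prop)]
        simp [innerSL_apply_apply]
    _ = ENNReal.ofReal (Real.exp (‖a‖ ^ 2 / 2)) := by
        rw [hmap, ← ofReal_integral_eq_lintegral_ofReal (by simpa using hi)
          (Eventually.of_forall fun _ => (Real.exp_pos _).le)]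
        congr 1
        simpa [mgf] using hm

/-- Decoupling: exp(‖T x‖²/4) is the Gaussian average over g in W of exp⟨T x/√2, g⟩. Exchanging the
integrals replaces T x by T* g, so the bound involves the dimension of W and not that of V. -/
lemma lintegral_exp_quarter_norm_sq_comp_le (T : V →L[ℝ] W) (hT : ‖T‖ ≤ 1) :
    ∫⁻ x, ENNReal.ofReal (Real.exp (‖T x‖ ^ 2 / 4)) ∂(stdGaussian V) ≤
      ENNReal.ofReal ((2 : ℝ) ^ ((Module.finrank ℝ W : ℝ) / 2)) := by
  set s : ℝ := (Real.sqrt 2)⁻¹ with hs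
  have hs2 : s ^ 2 = 1 / 2 := by rw [hs, inv_pow, Real.sq_sqrt (by norm_num)]; norm_num
  calc ∫⁻ x, ENNReal.ofReal (Real.exp (‖T x‖ ^ 2 / 4)) ∂(stdGaussian V)
      = ∫⁻ x, ∫⁻ g, ENNReal.ofReal (Real.exp (inner ℝ (s • T x) g)) ∂(stdGaussian W)
          ∂(stdGaussian V) := by
        refine lintegral_congr fun x => ?_
        rw [lintegral_exp_inner_stdGaussian]
        rw [norm_smul, mul_pow, Real.norm_eq_abs, sq_abs, hs2]; congr 2; ring
    _ = ∫⁻ g, ∫⁻ x, ENNReal.ofReal (Real.exp (inner ℝ (s • T x) g)) ∂(stdGaussian V)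
          ∂(stdGaussian W) := by
        refine lintegral_lintegral_swap ?_
        have hc : Continuous fun p : V × W => Real.exp (inner ℝ (s • T p.1) p.2) := by fun_prop
        exact hc.measurable.ennreal_ofReal.aemeasurable
    _ = ∫⁻ g, ENNReal.ofReal (Real.exp (‖T.adjoint g‖ ^ 2 / 4)) ∂(stdGaussian W) := by
        refine lintegral_congr fun g => ?_
        have : ∀ x, inner ℝ (s • T x) g = inner ℝ (s • T.adjoint g) x := by
          intro x
          rw [real_inner_smul_left, real_inner_smul_left, ContinuousLinearMap.adjoint_inner_left,
            real_inner_comm]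
        rw [lintegral_congr fun x => by rw [this x], lintegral_exp_inner_stdGaussian]
        rw [norm_smul, mul_pow, Real.norm_eq_abs, sq_abs, hs2]; congr 2; ring
    _ ≤ ∫⁻ g, ENNReal.ofReal (Real.exp (‖g‖ ^ 2 / 4)) ∂(stdGaussian W) := by
        refine lintegral_mono fun g => ENNReal.ofReal_le_ofReal (Real.exp_le_exp.2 ?_)
        have h1 : ‖T.adjoint g‖ ≤ ‖g‖ := by
          refine (T.adjoint.le_opNorm g).trans ?_
          rw [LinearIsometryEquiv.norm_map]
          exact mul_le_of_le_one_left (norm_nonneg _) hT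
        gcongr
    _ = _ := lintegral_exp_quarter_norm_sq_stdGaussian

lemma stdGaussian_le_norm_sq_comp (T : V →L[ℝ] W) (hT : ‖T‖ ≤ 1) (M : ℝ) :
    stdGaussian V {x | M ≤ ‖T x‖ ^ 2} ≤
      ENNReal.ofReal ((2 : ℝ) ^ ((Module.finrank ℝ W : ℝ) / 2) * Real.exp (-(M / 4))) := by
  have h := mul_meas_ge_le_lintegral (μ := stdGaussian V)
    (f := fun x => ENNReal.ofReal (Real.exp (‖T x‖ ^ 2 / 4)))
    (by fun_prop) (ENNReal.ofReal (Real.exp (M / 4)))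
  have hset : {x | ENNReal.ofReal (Real.exp (M / 4)) ≤ ENNReal.ofReal (Real.exp (‖T x‖ ^ 2 / 4))}
      = {x | M ≤ ‖T x‖ ^ 2} := by
    ext x
    simp only [Set.mem_ofPred_eq]
    rw [ENNReal.ofReal_le_ofReal_iff (Real.exp_pos _).le, Real.exp_le_exp]
    constructor <;> intro h <;> linarith
  rw [hset] at h
  have h' := h.trans (lintegral_exp_quarter_norm_sq_comp_le T hT)
  rw [Real.exp_neg, ← div_eq_mul_inv, ENNReal.ofReal_div_of_pos (Real.exp_pos _)]
  rw [ENNReal.le_div_iff_mul_le (Or.inl (by simp [Real.exp_pos])) (Or.inl ENNReal.ofReal_ne_top),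
    mul_comm]
  exact h'

/-- A Chernoff bound relative to the normalizing integral: halving the exponent q/2 multiplies its
Lebesgue integral by exactly 2^{dim/2}, by scaling with √2. -/
lemma setLIntegral_posterior_le (G : V →L[ℝ] W) (y : W) (m : V)
    (hm : m + G.adjoint (G m) = G.adjoint y) {B : Set V} (hB : MeasurableSet B) (ρ : ℝ)
    (hρ : ∀ z ∈ B, ρ ≤ ‖z - m‖ ^ 2 + ‖G (z - m)‖ ^ 2) :
    ∫⁻ z in B, ENNReal.ofReal (Real.exp (-(1 / 2) * ‖y - G z‖ ^ 2)) ∂(stdGaussian V) ≤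
      ENNReal.ofReal ((2 : ℝ) ^ ((Module.finrank ℝ V : ℝ) / 2) * Real.exp (-(ρ / 4))) *
        ∫⁻ z, ENNReal.ofReal (Real.exp (-(1 / 2) * ‖y - G z‖ ^ 2)) ∂(stdGaussian V) := by
  set q : V → ℝ := fun t => ‖t‖ ^ 2 + ‖G t‖ ^ 2 with hq
  set κ : ℝ := ((2 * Real.pi) ^ ((Module.finrank ℝ V : ℝ) / 2))⁻¹ *
    Real.exp (-(1 / 2) * (‖m‖ ^ 2 + ‖y - G m‖ ^ 2)) with hκ
  have hκ0 : 0 ≤ κ := by positivity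
  have hqc : Continuous q := by fun_prop
  have hjoint : ∀ z, ENNReal.ofReal (stdDensity V z) *
      ENNReal.ofReal (Real.exp (-(1 / 2) * ‖y - G z‖ ^ 2)) =
      ENNReal.ofReal κ * ENNReal.ofReal (Real.exp (-(1 / 2) * q (z - m))) := by
    intro z
    rw [← ENNReal.ofReal_mul (stdDensity_nonneg _), ← ENNReal.ofReal_mul hκ0, stdDensity, hκ,
      mul_assoc, mul_assoc, ← Real.exp_add, ← Real.exp_add]
    congr 3
    have := complete_square G y m hm z
    simp only [hq]
    linear_combination (-1 / 2 : ℝ) * this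
  have hden : ∫⁻ z, ENNReal.ofReal (Real.exp (-(1 / 2) * ‖y - G z‖ ^ 2)) ∂(stdGaussian V) =
      ENNReal.ofReal κ * ∫⁻ t, ENNReal.ofReal (Real.exp (-(1 / 2) * q t)) := by
    rw [lintegral_stdGaussian (by fun_prop)]
    simp_rw [hjoint]
    rw [lintegral_const_mul _ (by fun_prop),
      lintegral_sub_right_eq_self (fun t => ENNReal.ofReal (Real.exp (-(1 / 2) * q t))) m]
  have hscale : ∫⁻ t, ENNReal.ofReal (Real.exp (-(1 / 4) * q t)) =
      ENNReal.ofReal ((2 : ℝ) ^ ((Module.finrank ℝ V : ℝ) / 2)) *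
        ∫⁻ t, ENNReal.ofReal (Real.exp (-(1 / 2) * q t)) := by
    rw [lintegral_eq_mul_lintegral_comp_sqrt_two_smul (by fun_prop)]
    congr 1
    refine lintegral_congr fun t => ?_
    congr 2
    simp only [hq, map_smul, norm_smul, mul_pow]
    rw [Real.norm_of_nonneg (by positivity), Real.sq_sqrt (by norm_num)]
    ring
  rw [hden]
  calc ∫⁻ z in B, ENNReal.ofReal (Real.exp (-(1 / 2) * ‖y - G z‖ ^ 2)) ∂(stdGaussian V)
      = ∫⁻ z, ENNReal.ofReal (stdDensity V z) *
          B.indicator (fun z => ENNReal.ofReal (Real.exp (-(1 / 2) * ‖y - G z‖ ^ 2))) z := by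
        rw [← lintegral_indicator hB,
          lintegral_stdGaussian (Measurable.indicator (by fun_prop) hB)]
    -- Split -q/2 into two copies of -q/4; on B one copy is at most -ρ/4.
    _ ≤ ∫⁻ z, ENNReal.ofReal κ * (ENNReal.ofReal (Real.exp (-(ρ / 4))) *
          ENNReal.ofReal (Real.exp (-(1 / 4) * q (z - m)))) := by
        refine lintegral_mono fun z => ?_
        by_cases hz : z ∈ B
        · simp only [Set.indicator_of_mem hz]
          rw [hjoint, ← ENNReal.ofReal_mul (Real.exp_pos _).le, ← Real.exp_add]
          refine mul_le_mul_right (ENNReal.ofReal_le_ofReal (Real.exp_le_exp.2 ?_)) _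
          have := hρ z hz
          simp only [hq]
          linarith
        · simp [Set.indicator_of_notMem hz]
    _ = _ := by
        rw [lintegral_const_mul _ (by fun_prop), lintegral_const_mul _ (by fun_prop),
          lintegral_sub_right_eq_self (fun t => ENNReal.ofReal (Real.exp (-(1 / 4) * q t))) m,
          hscale, ENNReal.ofReal_mul (p := 2 ^ _) (by positivity)]
        ring

end StdGaussian

/-! ### The posterior mean as a ridge estimator: bias and noise. -/

section Ridge

variable {V W : Type*} [NormedAddCommGroup V] [InnerProductSpace ℝ V] [FiniteDimensional ℝ V]
  [NormedAddCommGroup W] [InnerProductSpace ℝ W] [FiniteDimensional ℝ W]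

/-- The posterior mean is a linear function of the observation. -/
lemma exists_posteriorMean (G : V →L[ℝ] W) :
    ∃ K : W →L[ℝ] V, ∀ y, K y + G.adjoint (G (K y)) = G.adjoint y := by
  let H : V →ₗ[ℝ] V := LinearMap.id + (G.adjoint.comp G).toLinearMap
  have hH : ∀ v, H v = v + G.adjoint (G v) := fun v => rfl
  have hinj : Function.Injective H := by
    rw [injective_iff_map_eq_zero]
    intro v hv
    have h1 : inner ℝ (H v) v = ‖v‖ ^ 2 + ‖G v‖ ^ 2 := by
      rw [hH, inner_add_left, ContinuousLinearMap.adjoint_inner_left, real_inner_self_eq_norm_sq,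
        real_inner_self_eq_norm_sq]
    rw [hv, inner_zero_left] at h1
    have : ‖v‖ = 0 := by nlinarith [sq_nonneg ‖v‖, sq_nonneg ‖G v‖]
    exact norm_eq_zero.1 this
  let e : V ≃ₗ[ℝ] V := LinearEquiv.ofInjectiveEndo H hinj
  refine ⟨LinearMap.toContinuousLinearMap (e.symm.toLinearMap ∘ₗ G.adjoint.toLinearMap),
    fun y => ?_⟩
  have : e (e.symm (G.adjoint y)) = G.adjoint y := e.apply_symm_apply _
  exact this

lemma norm_map_posteriorMean_le (G : V →L[ℝ] W) (m : V) (y : W)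
    (hm : m + G.adjoint (G m) = G.adjoint y) : ‖G m‖ ≤ ‖y‖ := by
  have h1 := congrArg (fun v => inner ℝ v m) hm
  simp only [inner_add_left, ContinuousLinearMap.adjoint_inner_left,
    real_inner_self_eq_norm_sq] at h1
  have h2 := real_inner_le_norm y (G m)
  by_contra h
  push Not at h
  nlinarith [sq_nonneg ‖m‖, norm_nonneg y, norm_nonneg (G m)]

/-- The posterior mean minimizes ‖z‖² + ‖y - G z‖²; comparison with the value ‖z₀‖² + ‖b‖² at z₀
bounds the residual. -/
lemma norm_map_posteriorMean_sub_le (G : V →L[ℝ] W) (m z₀ : V) (b : W)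
    (hm : m + G.adjoint (G m) = G.adjoint (G z₀ + b)) :
    ‖G (m - z₀)‖ ^ 2 ≤ 2 * ‖z₀‖ ^ 2 + 4 * ‖b‖ ^ 2 := by
  have h1 := complete_square G (G z₀ + b) m hm z₀
  rw [add_sub_cancel_left] at h1
  have h2 : ‖G z₀ + b - G m‖ ^ 2 ≤ ‖z₀‖ ^ 2 + ‖b‖ ^ 2 := by
    nlinarith [sq_nonneg ‖z₀ - m‖, sq_nonneg ‖G (z₀ - m)‖, sq_nonneg ‖m‖]
  have h3 : G (m - z₀) = b - (G z₀ + b - G m) := by rw [map_sub]; abel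
  rw [h3]
  have h4 := parallelogram_law_with_norm ℝ b (G z₀ + b - G m)
  nlinarith [sq_nonneg ‖b + (G z₀ + b - G m)‖]

/-- Deviations of size `s` of the image `R z` of the parameter from the image of the true value
`z₀` force large values of the posterior quadratic form, when the image `T w` of the noise and the
bias are small. -/
lemma le_posterior_form (G : V →L[ℝ] W) (R : V →L[ℝ] V) (K : W →L[ℝ] V)
    (hK : ∀ y, K y + G.adjoint (G (K y)) = G.adjoint y) {a : ℝ} (ha : 0 ≤ a)
    (hR : ∀ z, a * ‖R z‖ ^ 2 ≤ ‖G z‖ ^ 2) (z₀ z : V) (b w : W) {β τ s : ℝ} (hβ : 0 ≤ β)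
    (hb : 2 * ‖z₀‖ ^ 2 + 4 * ‖b‖ ^ 2 ≤ β ^ 2)
    (hw : ‖(Real.sqrt a • R.comp K) w‖ ≤ τ) (hs : 0 ≤ s)
    (hz : s + β + τ ≤ Real.sqrt a * ‖R (z - z₀)‖) :
    s ^ 2 ≤ ‖z - K (G z₀ + b + w)‖ ^ 2 + ‖G (z - K (G z₀ + b + w))‖ ^ 2 := by
  have hsa := Real.sqrt_nonneg a
  have hR' : ∀ z, Real.sqrt a * ‖R z‖ ≤ ‖G z‖ := fun z => by
    refine le_of_sq_le_sq ?_ (norm_nonneg _)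
    rw [mul_pow, Real.sq_sqrt ha]
    exact hR z
  have h1 : ‖G (K (G z₀ + b) - z₀)‖ ≤ β :=
    le_of_sq_le_sq ((norm_map_posteriorMean_sub_le G _ z₀ b (hK _)).trans hb) hβ
  have h2 : Real.sqrt a * ‖R (K w)‖ ≤ τ := by
    simpa [norm_smul, abs_of_nonneg hsa] using hw
  -- Posterior spread, bias and noise; linearity of K separates the last two.
  have h3 : R (z - z₀) = R (z - K (G z₀ + b + w)) + R (K (G z₀ + b) - z₀) + R (K w) := by
    rw [← map_add, ← map_add]; congr 1; rw [map_add K (G z₀ + b) w]; abel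
  have h4 : ‖R (z - z₀)‖ ≤
      ‖R (z - K (G z₀ + b + w))‖ + ‖R (K (G z₀ + b) - z₀)‖ + ‖R (K w)‖ := by
    rw [h3]; exact norm_add₃_le
  have h5 := hR' (z - K (G z₀ + b + w))
  have h6 := hR' (K (G z₀ + b) - z₀)
  have h7 : s ≤ ‖G (z - K (G z₀ + b + w))‖ := by
    have := mul_le_mul_of_nonneg_left h4 hsa
    rw [mul_add, mul_add] at this
    linarith
  nlinarith [sq_nonneg ‖z - K (G z₀ + b + w)‖]

lemma norm_sqrt_smul_comp_posteriorMean_le (G : V →L[ℝ] W) (R : V →L[ℝ] V) (K : W →L[ℝ] V)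
    (hK : ∀ y, K y + G.adjoint (G (K y)) = G.adjoint y) {a : ℝ} (ha : 0 ≤ a)
    (hR : ∀ z, a * ‖R z‖ ^ 2 ≤ ‖G z‖ ^ 2) : ‖Real.sqrt a • R.comp K‖ ≤ 1 := by
  refine ContinuousLinearMap.opNorm_le_bound _ zero_le_one fun w => ?_
  rw [one_mul]
  refine le_trans ?_ (norm_map_posteriorMean_le G (K w) w (hK w))
  refine le_of_sq_le_sq ?_ (norm_nonneg _)
  simp only [_root_.smul_apply, ContinuousLinearMap.comp_apply, norm_smul, mul_pow,
    Real.norm_eq_abs, sq_abs, Real.sq_sqrt ha]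
  exact hR _

end Ridge

/-! ### Whitening by the square root of the covariance. -/

section Whitening

open scoped MatrixOrder

variable {n : ℕ}

lemma sqrt_mul_sqrt_of_posDef {S : Matrix (Fin n) (Fin n) ℝ} (hS : S.PosDef) :
    CFC.sqrt S * CFC.sqrt S = S := by
  exact CFC.sqrt_mul_sqrt_self S hS.posSemidef.nonneg

lemma isUnit_sqrt_of_posDef {S : Matrix (Fin n) (Fin n) ℝ} (hS : S.PosDef) :
    IsUnit (CFC.sqrt S).det := by
  have h : (CFC.sqrt S).det * (CFC.sqrt S).det = S.det := by
    rw [← Matrix.det_mul, sqrt_mul_sqrt_of_posDef hS]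
  have h2 := hS.det_pos
  rw [isUnit_iff_ne_zero]
  intro h0
  rw [h0] at h
  linarith

lemma sqrt_transpose (S : Matrix (Fin n) (Fin n) ℝ) : (CFC.sqrt S)ᵀ = CFC.sqrt S := by
  have h : (CFC.sqrt S)ᴴ = CFC.sqrt S := (CFC.sqrt_nonneg S).isSelfAdjoint
  rwa [Matrix.conjTranspose_eq_transpose_of_trivial] at h

/-- Multiplication by `S^{1/2}`. -/
noncomputable def sqrtCLM (S : Matrix (Fin n) (Fin n) ℝ) :
    EuclideanSpace ℝ (Fin n) →L[ℝ] EuclideanSpace ℝ (Fin n) :=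
  toEuclideanCLM (𝕜 := ℝ) (CFC.sqrt S)

/-- Multiplication by `S^{-1/2}`. -/
noncomputable def whitening (S : Matrix (Fin n) (Fin n) ℝ) :
    EuclideanSpace ℝ (Fin n) →L[ℝ] EuclideanSpace ℝ (Fin n) :=
  toEuclideanCLM (𝕜 := ℝ) (CFC.sqrt S)⁻¹

lemma whitening_sqrtCLM {S : Matrix (Fin n) (Fin n) ℝ} (hS : S.PosDef)
    (x : EuclideanSpace ℝ (Fin n)) : whitening S (sqrtCLM S x) = x := by
  rw [whitening, sqrtCLM, ← mul_apply_eq_comp, ← map_mul,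
    Matrix.nonsing_inv_mul _ (isUnit_sqrt_of_posDef hS), map_one]
  rfl

lemma sqrtCLM_whitening {S : Matrix (Fin n) (Fin n) ℝ} (hS : S.PosDef)
    (x : EuclideanSpace ℝ (Fin n)) : sqrtCLM S (whitening S x) = x := by
  rw [whitening, sqrtCLM, ← mul_apply_eq_comp, ← map_mul,
    Matrix.mul_nonsing_inv _ (isUnit_sqrt_of_posDef hS), map_one]
  rfl

lemma precForm_eq_norm_sq {S : Matrix (Fin n) (Fin n) ℝ} (hS : S.PosDef)
    (x : EuclideanSpace ℝ (Fin n)) : precForm S x.ofLp = ‖whitening S x‖ ^ 2 := by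
  have h1 : S⁻¹ = (CFC.sqrt S)⁻¹ * (CFC.sqrt S)⁻¹ := by
    rw [← Matrix.mul_inv_rev, sqrt_mul_sqrt_of_posDef hS]
  have h2 : (whitening S x).ofLp = (CFC.sqrt S)⁻¹ *ᵥ x.ofLp := rfl
  have h3 : x.ofLp ᵥ* (CFC.sqrt S)⁻¹ = (CFC.sqrt S)⁻¹ *ᵥ x.ofLp := by
    rw [← Matrix.mulVec_transpose, Matrix.transpose_nonsing_inv, sqrt_transpose]
  rw [precForm, h1, ← Matrix.mulVec_mulVec, Matrix.dotProduct_mulVec, h3,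
    EuclideanSpace.real_norm_sq_eq, h2]
  simp [dotProduct, sq]

lemma multivariateGaussian_eq_map (μ : EuclideanSpace ℝ (Fin n)) (S : Matrix (Fin n) (Fin n) ℝ) :
    multivariateGaussian μ S =
      (stdGaussian (EuclideanSpace ℝ (Fin n))).map (fun x => μ + sqrtCLM S x) := rfl

end Whitening

/-! ### Truncation, padding and the smoothness of θ₀. -/

section Coordinates

lemma pad_apply (k : ℕ) (u : EuclideanSpace ℝ (Fin k)) (j : ℕ) :
    pad k u j = if h : j < k then u ⟨j, h⟩ else 0 := by
  have h1 : pad k u = ∑ i : Fin k, lp.single 2 (i : ℕ) (u i) := by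
    simp [pad]
  rw [h1, lp.coeFn_sum, Finset.sum_apply]
  split_ifs with h
  · rw [Finset.sum_eq_single ⟨j, h⟩]
    · simp
    · intro i _ hi
      rw [lp.single_apply_ne]
      exact fun e => hi (Fin.ext e.symm)
    · simp
  · refine Finset.sum_eq_zero fun i _ => ?_
    rw [lp.single_apply_ne]
    have := i.2
    omega

lemma norm_trunc_sq (n : ℕ) (θ : Param) : ‖trunc n θ‖ ^ 2 = ∑ i ∈ Finset.range n, θ i ^ 2 := by
  rw [EuclideanSpace.real_norm_sq_eq, ← Fin.sum_univ_eq_sum_range (fun i => θ i ^ 2)]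
  rfl

lemma param_hasSum_sq (θ : Param) : HasSum (fun i => θ i ^ 2) (‖θ‖ ^ 2) := by
  have h := lp.hasSum_norm (by norm_num : 0 < (2 : ℝ≥0∞).toReal) θ
  simpa using h

lemma norm_trunc_le (n : ℕ) (θ : Param) : ‖trunc n θ‖ ≤ ‖θ‖ := by
  refine le_of_sq_le_sq ?_ (norm_nonneg _)
  rw [norm_trunc_sq]
  exact sum_le_hasSum _ (fun i _ => sq_nonneg _) (param_hasSum_sq θ)

lemma trunc_pad (k : ℕ) (u : EuclideanSpace ℝ (Fin k)) : trunc k (pad k u) = u := by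
  ext i
  simp [trunc, pad_apply]

lemma norm_pad (k : ℕ) (u : EuclideanSpace ℝ (Fin k)) : ‖pad k u‖ = ‖u‖ := by
  have h1 : HasSum (fun i => pad k u i ^ 2) (∑ i ∈ Finset.range k, pad k u i ^ 2) := by
    refine hasSum_sum_of_ne_finset_zero fun i hi => ?_
    rw [pad_apply, dif_neg (by simpa using hi)]
    norm_num
  rw [← norm_trunc_sq, trunc_pad] at h1
  have h2 := (param_hasSum_sq (pad k u)).unique h1
  exact (sq_eq_sq₀ (norm_nonneg _) (norm_nonneg _)).1 h2

lemma norm_le_norm_trunc_pad {k n : ℕ} (hkn : k ≤ n) (u : EuclideanSpace ℝ (Fin k)) :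
    ‖u‖ ≤ ‖trunc n (pad k u)‖ := by
  refine le_of_sq_le_sq ?_ (norm_nonneg _)
  conv_lhs => rw [← trunc_pad k u]
  rw [norm_trunc_sq, norm_trunc_sq]
  exact Finset.sum_le_sum_of_subset_of_nonneg (Finset.range_mono hkn) fun i _ _ => sq_nonneg _

/-- Truncation as a continuous linear map. -/
noncomputable def truncCLM (n : ℕ) : Param →L[ℝ] EuclideanSpace ℝ (Fin n) :=
  LinearMap.mkContinuous
    { toFun := trunc n
      map_add' := fun x y => by ext i; simp [trunc]
      map_smul' := fun c x => by ext i; simp [trunc] } 1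
    (fun θ => by simpa using norm_trunc_le n θ)

@[simp]
lemma truncCLM_apply (n : ℕ) (θ : Param) : truncCLM n θ = trunc n θ := rfl

lemma norm_sub_pad_trunc_sq_le {γ : ℝ} (hγ : 0 ≤ γ) {θ : Param} (hθ : CondB γ θ) {k : ℕ} {x : ℝ}
    (hx : 0 < x) (hxk : x ≤ k + 1) :
    ‖θ - pad k (trunc k θ)‖ ^ 2 ≤
      x ^ (-(2 * γ)) * ∑' i : ℕ, θ i ^ 2 * ((i : ℝ) + 1) ^ (2 * γ) := by
  refine hasSum_le (fun i => ?_) (param_hasSum_sq _) (hθ.hasSum.mul_left _)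
  rw [lp.coeFn_sub, Pi.sub_apply, pad_apply]
  split_ifs with h
  · simp only [trunc, sub_self, zero_pow two_ne_zero]
    positivity
  · rw [sub_zero]
    -- The first discarded coordinate has one-based index k + 1, so x ≤ k + 1 suffices and x may
    -- exceed k.
    have h1 : x ≤ (i : ℝ) + 1 := by
      have : (k : ℝ) ≤ i := by exact_mod_cast not_lt.1 h
      linarith
    have h2 : x ^ (2 * γ) ≤ ((i : ℝ) + 1) ^ (2 * γ) :=
      Real.rpow_le_rpow hx.le h1 (by positivity)
    have h3 : 0 < x ^ (2 * γ) := by positivity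
    rw [Real.rpow_neg hx.le, ← div_eq_inv_mul, le_div_iff₀ h3]
    exact mul_le_mul_of_nonneg_left h2 (sq_nonneg _)

lemma sum_fin_trunc_le {γ : ℝ} {θ : Param} (hθ : CondB γ θ) (k : ℕ) :
    ∑ i : Fin k, trunc k θ i ^ 2 * ((i : ℕ) + 1 : ℝ) ^ (2 * γ) ≤
      ∑' i : ℕ, θ i ^ 2 * ((i : ℝ) + 1) ^ (2 * γ) := by
  have h := Fin.sum_univ_eq_sum_range (fun i : ℕ => θ i ^ 2 * ((i : ℝ) + 1) ^ (2 * γ)) k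
  calc _ = ∑ i ∈ Finset.range k, θ i ^ 2 * ((i : ℝ) + 1) ^ (2 * γ) := h
    _ ≤ _ := hθ.sum_le_tsum _ (fun i _ => by positivity)

end Coordinates

/-! ### Posterior contraction for fixed n. -/

section FiniteSample

variable {k n : ℕ}

/-- The whitened mean of the observation as a function of the whitened parameter. -/
noncomputable def design (Sn : Matrix (Fin n) (Fin n) ℝ) (S : Matrix (Fin k) (Fin k) ℝ) :
    EuclideanSpace ℝ (Fin k) →L[ℝ] EuclideanSpace ℝ (Fin n) :=
  (whitening Sn).comp ((truncCLM n).comp ((pad k).comp (sqrtCLM S)))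

lemma design_apply (Sn : Matrix (Fin n) (Fin n) ℝ) (S : Matrix (Fin k) (Fin k) ℝ)
    (z : EuclideanSpace ℝ (Fin k)) :
    design Sn S z = whitening Sn (trunc n (pad k (sqrtCLM S z))) := rfl

lemma lintegral_prior (S : Matrix (Fin k) (Fin k) ℝ) {f : Param → ℝ≥0∞} (hf : Measurable f) :
    ∫⁻ θ, f θ ∂(prior k S) =
      ∫⁻ z, f (pad k (sqrtCLM S z)) ∂(stdGaussian (EuclideanSpace ℝ (Fin k))) := by
  rw [prior, multivariateGaussian_eq_map, lintegral_map hf (by fun_prop),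
    lintegral_map (by fun_prop) (by fun_prop)]
  simp

lemma bayesPosterior_le {Sn : Matrix (Fin n) (Fin n) ℝ} (hSn : Sn.PosDef)
    (S : Matrix (Fin k) (Fin k) ℝ) (x : EuclideanSpace ℝ (Fin n)) {B : Set Param}
    (hB : MeasurableSet B) (m : EuclideanSpace ℝ (Fin k))
    (hm : m + (design Sn S).adjoint (design Sn S m) = (design Sn S).adjoint (whitening Sn x))
    (ρ : ℝ)
    (hρ : ∀ z, pad k (sqrtCLM S z) ∈ B → ρ ≤ ‖z - m‖ ^ 2 + ‖design Sn S (z - m)‖ ^ 2) :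
    bayesPosterior Sn (prior k S) x B ≤
      ENNReal.ofReal ((2 : ℝ) ^ ((k : ℝ) / 2) * Real.exp (-(ρ / 4))) := by
  set N : ℝ := (Real.sqrt ((2 * Real.pi) ^ n * Sn.det))⁻¹ with hN
  have hN0 : 0 ≤ N := by positivity
  have hdens : ∀ θ : Param, ENNReal.ofReal (gaussDensity (trunc n θ) Sn x) =
      ENNReal.ofReal N *
        ENNReal.ofReal (Real.exp (-(1 / 2) * ‖whitening Sn (x - truncCLM n θ)‖ ^ 2)) := by
    intro θ
    rw [← ENNReal.ofReal_mul hN0, gaussDensity, precForm_eq_norm_sq hSn, truncCLM_apply]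
  have hpad : Measurable fun z => pad k (sqrtCLM S z) := by fun_prop
  have hG : ∀ z, whitening Sn (x - truncCLM n (pad k (sqrtCLM S z))) =
      whitening Sn x - design Sn S z := fun z => by rw [map_sub]; rfl
  have hmeas : Measurable fun θ : Param =>
      ENNReal.ofReal (Real.exp (-(1 / 2) * ‖whitening Sn (x - truncCLM n θ)‖ ^ 2)) := by
    fun_prop
  have hden : ∫⁻ θ, ENNReal.ofReal (gaussDensity (trunc n θ) Sn x) ∂(prior k S) =
      ENNReal.ofReal N * ∫⁻ z, ENNReal.ofReal
        (Real.exp (-(1 / 2) * ‖whitening Sn x - design Sn S z‖ ^ 2))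
          ∂(stdGaussian (EuclideanSpace ℝ (Fin k))) := by
    simp_rw [hdens]
    rw [lintegral_const_mul _ hmeas, lintegral_prior S hmeas]
    simp_rw [hG]
  have hnum : ∫⁻ θ in B, ENNReal.ofReal (gaussDensity (trunc n θ) Sn x) ∂(prior k S) =
      ENNReal.ofReal N * ∫⁻ z in (fun z => pad k (sqrtCLM S z)) ⁻¹' B, ENNReal.ofReal
        (Real.exp (-(1 / 2) * ‖whitening Sn x - design Sn S z‖ ^ 2))
          ∂(stdGaussian (EuclideanSpace ℝ (Fin k))) := by
    simp_rw [hdens]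
    rw [lintegral_const_mul _ hmeas, ← lintegral_indicator hB,
      lintegral_prior S (hmeas.indicator hB), ← lintegral_indicator (hpad hB)]
    simp_rw [← hG]
    rfl
  rw [bayesPosterior]
  -- In this form the denominator of Bayes' formula need not be shown positive or finite; the factor
  -- N occurs on both sides.
  refine ENNReal.div_le_of_le_mul ?_
  rw [hnum, hden, mul_left_comm]
  refine mul_le_mul_right ?_ _
  have h := setLIntegral_posterior_le (design Sn S) (whitening Sn x) m hm (hpad hB) ρ
    (fun z hz => hρ z hz)
  simpa using h

/-- The reason for the threshold 8x: e^{-2x} beats the dimensional factor 2^{k/2} ≤ e^{x/2}. It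
serves both the posterior tail and the noise tail. -/
lemma two_rpow_half_mul_exp_le {x : ℝ} (hk : (k : ℝ) ≤ x) :
    (2 : ℝ) ^ ((k : ℝ) / 2) * Real.exp (-(8 * x / 4)) ≤ Real.exp (-x) := by
  have h1 : (2 : ℝ) ^ ((k : ℝ) / 2) ≤ Real.exp ((k : ℝ) / 2) := by
    rw [← Real.exp_one_rpow]
    exact Real.rpow_le_rpow (by norm_num) (by linarith [Real.add_one_le_exp (1 : ℝ)])
      (by positivity)
  refine (mul_le_mul_of_nonneg_right h1 (Real.exp_pos _).le).trans ?_
  rw [← Real.exp_add, Real.exp_le_exp]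
  have : (0 : ℝ) ≤ k := by positivity
  linarith

/-- The constant `r` of the contraction rate, in terms of the constants of the conditions. -/
noncomputable def contractionRadius (a₁ a₂ C D : ℝ) : ℝ :=
  Real.sqrt D + (Real.sqrt ((2 * C + 4 * a₂) * D) + 2 * Real.sqrt 8) / Real.sqrt a₁

/-- Posterior contraction in a fixed sample, on the event that the image of the noise is small. -/
lemma exists_noise_map_bayesPosterior_le {γ : ℝ} (hγ : 0 < γ) {θ₀ : Param} (hb : CondB γ θ₀)
    {Sn : Matrix (Fin n) (Fin n) ℝ} (hSn : Sn.PosDef) {S : Matrix (Fin k) (Fin k) ℝ}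
    (hS : S.PosDef) {a₁ a₂ C x : ℝ} (ha₁ : 0 < a₁) (ha₂ : 0 < a₂) (hC : 0 < C)
    (hA₁ : ∀ α : Fin n → ℝ, a₁ * (n * ∑ i, α i ^ 2) ≤ precForm Sn α)
    (hA₂ : ∀ α : Fin n → ℝ, precForm Sn α ≤ a₂ * (n * ∑ i, α i ^ 2))
    (hprior : ∀ α : Fin k → ℝ,
      precForm S α ≤ C * (k * ∑ i, α i ^ 2 * ((i : ℕ) + 1 : ℝ) ^ (2 * γ)))
    (hkn : k ≤ n) (hx0 : 0 < x) (hkx : (k : ℝ) ≤ x) (hxk : x ≤ k + 1)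
    (hxn : x ^ (2 * γ + 1) = n) :
    ∃ T : EuclideanSpace ℝ (Fin n) →L[ℝ] EuclideanSpace ℝ (Fin k), ‖T‖ ≤ 1 ∧
      ∀ w, ‖T w‖ ^ 2 ≤ 8 * x →
        bayesPosterior Sn (prior k S) (trunc n θ₀ + sqrtCLM Sn w)
          {θ : Param | contractionRadius a₁ a₂ C
            (∑' i : ℕ, θ₀ i ^ 2 * ((i : ℝ) + 1) ^ (2 * γ)) * x ^ (-γ) ≤ ‖θ - θ₀‖} ≤
        ENNReal.ofReal (Real.exp (-x)) := by
  set D : ℝ := ∑' i : ℕ, θ₀ i ^ 2 * ((i : ℝ) + 1) ^ (2 * γ) with hD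
  have hD0 : 0 ≤ D := tsum_nonneg fun i => by positivity
  set G := design Sn S with hG
  obtain ⟨K, hK⟩ := exists_posteriorMean G
  have hn0 : (0 : ℝ) < n := by rw [← hxn]; positivity
  have ha : 0 < a₁ * n := by positivity
  have hlow : ∀ v : EuclideanSpace ℝ (Fin n), a₁ * n * ‖v‖ ^ 2 ≤ ‖whitening Sn v‖ ^ 2 := by
    intro v
    rw [← precForm_eq_norm_sq hSn, EuclideanSpace.real_norm_sq_eq, mul_assoc]
    exact hA₁ _
  have hupp : ∀ v : EuclideanSpace ℝ (Fin n), ‖whitening Sn v‖ ^ 2 ≤ a₂ * n * ‖v‖ ^ 2 := by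
    intro v
    rw [← precForm_eq_norm_sq hSn, EuclideanSpace.real_norm_sq_eq, mul_assoc]
    exact hA₂ _
  have hR : ∀ z, a₁ * n * ‖sqrtCLM S z‖ ^ 2 ≤ ‖G z‖ ^ 2 := by
    intro z
    rw [hG, design_apply]
    refine le_trans ?_ (hlow _)
    have := norm_le_norm_trunc_pad hkn (sqrtCLM S z)
    gcongr
  set T := Real.sqrt (a₁ * n) • (sqrtCLM S).comp K with hT
  refine ⟨T, norm_sqrt_smul_comp_posteriorMean_le G _ K hK ha.le hR, fun w hw => ?_⟩
  set z₀ := whitening S (trunc k θ₀) with hz₀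
  have hRz₀ : sqrtCLM S z₀ = trunc k θ₀ := sqrtCLM_whitening hS _
  set δ : Param := θ₀ - pad k (trunc k θ₀) with hδ
  set b := whitening Sn (trunc n δ) with hbdef
  have hδ2 : ‖δ‖ ^ 2 ≤ x ^ (-(2 * γ)) * D := norm_sub_pad_trunc_sq_le hγ.le hb hx0 hxk
  have hxpow : x ^ (-(2 * γ)) = (x ^ (-γ)) ^ 2 := by
    rw [← Real.rpow_mul_natCast hx0.le]; congr 1; push_cast; ring
  -- The balance that fixes the rate: squared truncation error times n equals the order of the
  -- dimension.
  have hnx : n * x ^ (-(2 * γ)) = x := by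
    rw [← hxn, ← Real.rpow_add hx0]; ring_nf; exact Real.rpow_one x
  have hz₀2 : ‖z₀‖ ^ 2 ≤ C * (x * D) := by
    rw [hz₀, ← precForm_eq_norm_sq hS]
    refine (hprior _).trans ?_
    have h1 := sum_fin_trunc_le hb k
    have h2 : 0 ≤ ∑ i : Fin k, trunc k θ₀ i ^ 2 * ((i : ℕ) + 1 : ℝ) ^ (2 * γ) :=
      Finset.sum_nonneg fun i _ => by positivity
    gcongr
  have hb2 : ‖b‖ ^ 2 ≤ a₂ * (x * D) := by
    refine (hupp _).trans ?_
    have h1 : ‖trunc n δ‖ ^ 2 ≤ x ^ (-(2 * γ)) * D := by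
      refine le_trans ?_ hδ2
      have := norm_trunc_le n δ
      gcongr
    calc a₂ * n * ‖trunc n δ‖ ^ 2 ≤ a₂ * n * (x ^ (-(2 * γ)) * D) := by gcongr
      _ = a₂ * ((n * x ^ (-(2 * γ))) * D) := by ring
      _ = a₂ * (x * D) := by rw [hnx]
  have hbias : 2 * ‖z₀‖ ^ 2 + 4 * ‖b‖ ^ 2 ≤ Real.sqrt ((2 * C + 4 * a₂) * D * x) ^ 2 := by
    rw [Real.sq_sqrt (by positivity)]
    linarith
  have hsplit : trunc n θ₀ = trunc n (pad k (trunc k θ₀)) + trunc n δ :=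
    (congrArg (trunc n) (by rw [hδ]; abel)).trans (map_add (truncCLM n) _ _)
  have hobs : whitening Sn (trunc n θ₀ + sqrtCLM Sn w) = G z₀ + b + w := by
    rw [map_add, whitening_sqrtCLM hSn, hG, design_apply, hRz₀, hbdef, hsplit, map_add]
  have hτ : ‖T w‖ ≤ Real.sqrt (8 * x) := Real.le_sqrt_of_sq_le hw
  have hrate : Real.sqrt (a₁ * n) * x ^ (-γ) = Real.sqrt a₁ * Real.sqrt x := by
    rw [Real.sqrt_mul ha₁.le, mul_assoc]
    congr 1
    conv_rhs => rw [← hnx]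
    rw [Real.sqrt_mul hn0.le, hxpow, Real.sqrt_sq (by positivity)]
  have hmeas : MeasurableSet {θ : Param | contractionRadius a₁ a₂ C D * x ^ (-γ) ≤ ‖θ - θ₀‖} :=
    measurableSet_le measurable_const (by fun_prop)
  refine (bayesPosterior_le hSn S _ hmeas (K (G z₀ + b + w)) (by rw [hobs]; exact hK _)
    (8 * x) fun z hz => ?_).trans (ENNReal.ofReal_le_ofReal (two_rpow_half_mul_exp_le hkx))
  have hsq : Real.sqrt (8 * x) ^ 2 = 8 * x := Real.sq_sqrt (by positivity)
  rw [← hsq]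
  -- Spread and noise are both allowed √(8x), whence 2√8 in `contractionRadius`; the other root
  -- there is the bias, and √D pays for the part δ of θ₀ that the prior cannot reach.
  refine le_posterior_form G (sqrtCLM S) K hK ha.le hR z₀ z b w (Real.sqrt_nonneg _) hbias hτ
    (Real.sqrt_nonneg _) ?_
  have hz' : contractionRadius a₁ a₂ C D * x ^ (-γ) ≤ ‖pad k (sqrtCLM S z) - θ₀‖ := hz
  have h1 : pad k (sqrtCLM S z) - θ₀ = pad k (sqrtCLM S (z - z₀)) - δ := by
    rw [map_sub (sqrtCLM S), map_sub (pad k), hRz₀, hδ]; abel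
  have h2 : ‖δ‖ ≤ Real.sqrt D * x ^ (-γ) := by
    refine le_of_sq_le_sq ?_ (by positivity)
    rw [mul_pow, Real.sq_sqrt hD0, ← hxpow, mul_comm]
    exact hδ2
  have h3 : (contractionRadius a₁ a₂ C D - Real.sqrt D) * x ^ (-γ) ≤ ‖sqrtCLM S (z - z₀)‖ := by
    have h4 := norm_sub_le (pad k (sqrtCLM S (z - z₀))) δ
    rw [← h1, norm_pad] at h4
    rw [sub_mul]
    linarith
  have h5 := mul_le_mul_of_nonneg_left h3 (Real.sqrt_nonneg (a₁ * n))
  have ha₁s : 0 < Real.sqrt a₁ := Real.sqrt_pos.2 ha₁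
  refine le_of_eq_of_le ?_ h5
  rw [mul_left_comm, hrate, contractionRadius, add_sub_cancel_left,
    Real.sqrt_mul (by norm_num : (0 : ℝ) ≤ 8), Real.sqrt_mul (by positivity)]
  field_simp
  ring

end FiniteSample

/-! ### Summability and the almost sure limit. -/

lemma summable_exp_neg_rpow {p : ℝ} (hp : 0 < p) :
    Summable fun n : ℕ => Real.exp (-(n : ℝ) ^ p) := by
  -- The exponent -2/p becomes n^{-2} after substituting n^p.
  have h := (isLittleO_exp_neg_mul_rpow_atTop (a := 1) one_pos (-2 / p)).isBigO
  have h2 : Tendsto (fun n : ℕ => (n : ℝ) ^ p) atTop atTop :=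
    (tendsto_rpow_atTop hp).comp tendsto_natCast_atTop_atTop
  have h3 := h.comp_tendsto h2
  refine summable_of_isBigO_nat (Real.summable_nat_rpow.2 (by norm_num : (-2 : ℝ) < -1)) ?_
  refine (h3.congr (fun n => ?_) (fun n => ?_))
  · simp
  · simp only [Function.comp_apply]
    rw [← Real.rpow_mul (by positivity)]
    congr 1
    field_simp

end InfNormal

theorem theorem7
    (γ : ℝ) (hγ : 0 < γ)
    (Sig : (n : ℕ) → Matrix (Fin n) (Fin n) ℝ) (hSig : ∀ n, (Sig n).PosDef)
    (ha : CondA Sig)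
    (θ₀ : Param) (hb : CondB γ θ₀) :
    ∃ c > (0 : ℝ),
      ∀ S : (k : ℕ) → Matrix (Fin k) (Fin k) ℝ,
        (∀ n, (S (priorDim γ c n)).PosDef) → CondC γ c S →
        ∃ r > (0 : ℝ),
          ∀ (Ω : Type*) [MeasurableSpace Ω] (P : Measure Ω) [IsProbabilityMeasure P]
            (X : (n : ℕ) → Ω → EuclideanSpace ℝ (Fin n)),
            (∀ n, HasLaw (X n) (multivariateGaussian (trunc n θ₀) (Sig n)) P) →
            ∀ᵐ ω ∂P, Tendsto
              (fun n : ℕ => bayesPosterior (Sig n) (prior (priorDim γ c n) (S (priorDim γ c n)))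
                (X n ω) {θ : Param | r * rate γ n ≤ ‖θ - θ₀‖})
              atTop (𝓝 0) := by
  obtain ⟨a₁, ha₁, a₂, ha₂, hA⟩ := ha
  -- c = 1 gives k ≤ n for n ≥ 1, so every coordinate charged by the prior is observed.
  refine ⟨1, one_pos, fun S hS ⟨C, hC, hprior⟩ => ?_⟩
  set D : ℝ := ∑' i : ℕ, θ₀ i ^ 2 * ((i : ℝ) + 1) ^ (2 * γ) with hD
  have hD0 : 0 ≤ D := tsum_nonneg fun i => by positivity
  refine ⟨contractionRadius a₁ a₂ C D, by unfold contractionRadius; positivity,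
    fun Ω _ P _ X hX => ?_⟩
  set p : ℝ := 1 / (2 * γ + 1) with hp
  have hp0 : 0 < p := by positivity
  have hp1 : p ≤ 1 := by rw [hp, div_le_one (by positivity)]; linarith
  have key : ∀ n : ℕ, 1 ≤ n →
      ∃ T : EuclideanSpace ℝ (Fin n) →L[ℝ] EuclideanSpace ℝ (Fin (priorDim γ 1 n)), ‖T‖ ≤ 1 ∧
        ∀ w, ‖T w‖ ^ 2 ≤ 8 * (n : ℝ) ^ p →
          bayesPosterior (Sig n) (prior (priorDim γ 1 n) (S (priorDim γ 1 n)))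
            (trunc n θ₀ + sqrtCLM (Sig n) w)
            {θ : Param | contractionRadius a₁ a₂ C D * rate γ n ≤ ‖θ - θ₀‖} ≤
          ENNReal.ofReal (Real.exp (-(n : ℝ) ^ p)) := by
    intro n hn
    have hn1 : (1 : ℝ) ≤ n := by exact_mod_cast hn
    have hx0 : 0 < (n : ℝ) ^ p := by positivity
    have hk : priorDim γ 1 n = ⌊(n : ℝ) ^ p⌋₊ := by rw [priorDim, mul_one]
    have hkx : (priorDim γ 1 n : ℝ) ≤ (n : ℝ) ^ p := by rw [hk]; exact Nat.floor_le hx0.le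
    have hrate : rate γ n = ((n : ℝ) ^ p) ^ (-γ) := by
      rw [rate, ← Real.rpow_mul (by positivity), hp]; congr 1; ring
    rw [hrate]
    refine exists_noise_map_bayesPosterior_le hγ hb (hSig n) (hS n) ha₁ ha₂ hC
      (fun α => (hA n α).1) (fun α => (hA n α).2) (hprior n) ?_ hx0 hkx ?_ ?_
    · have h1 : (n : ℝ) ^ p ≤ n := by
        simpa using Real.rpow_le_rpow_of_exponent_le hn1 hp1
      exact_mod_cast hkx.trans h1
    · rw [hk]; exact (Nat.lt_floor_add_one _).le
    · rw [← Real.rpow_mul (by positivity), hp, one_div, inv_mul_cancel₀ (by positivity),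
        Real.rpow_one]
  -- These sets need not be measurable: they are covered by measurable noise events, and
  -- Borel–Cantelli uses only their outer measure.
  set bad : ℕ → Set Ω := fun n => {ω | ¬ bayesPosterior (Sig n)
    (prior (priorDim γ 1 n) (S (priorDim γ 1 n))) (X n ω)
    {θ : Param | contractionRadius a₁ a₂ C D * rate γ n ≤ ‖θ - θ₀‖} ≤
      ENNReal.ofReal (Real.exp (-(n : ℝ) ^ p))} with hbad
  have hprob : ∀ n, P (bad n) ≤ ENNReal.ofReal (Real.exp (-(n : ℝ) ^ p)) := by
    intro n
    -- For n = 0 the bound is e^0 = 1.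
    rcases Nat.eq_zero_or_pos n with rfl | hn
    · refine prob_le_one.trans ?_
      simp [Real.zero_rpow hp0.ne']
    obtain ⟨T, hT, hpost⟩ := key n hn
    have hmeas : MeasurableSet {y : EuclideanSpace ℝ (Fin n) |
        8 * (n : ℝ) ^ p ≤ ‖T (whitening (Sig n) (y - trunc n θ₀))‖ ^ 2} :=
      measurableSet_le measurable_const (by fun_prop)
    calc P (bad n)
        ≤ P {ω | 8 * (n : ℝ) ^ p ≤ ‖T (whitening (Sig n) (X n ω - trunc n θ₀))‖ ^ 2} := by
          refine measure_mono fun ω hω => ?_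
          by_contra h
          refine hω ?_
          have h2 := hpost _ (not_le.1 h).le
          rwa [sqrtCLM_whitening (hSig n), add_sub_cancel] at h2
      _ = stdGaussian (EuclideanSpace ℝ (Fin n)) {w | 8 * (n : ℝ) ^ p ≤ ‖T w‖ ^ 2} := by
          rw [(hX n).measure_eq hmeas, multivariateGaussian_eq_map,
            Measure.map_apply (by fun_prop) hmeas]
          simp [whitening_sqrtCLM (hSig n)]
      _ ≤ _ := stdGaussian_le_norm_sq_comp T hT _
      _ ≤ _ := by
          refine ENNReal.ofReal_le_ofReal ?_
          rw [finrank_euclideanSpace_fin]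
          refine two_rpow_half_mul_exp_le ?_
          rw [priorDim, mul_one]
          exact Nat.floor_le (by positivity)
  have hsum : ∑' n, P (bad n) ≠ ∞ := by
    refine ne_top_of_le_ne_top ?_ (ENNReal.tsum_le_tsum hprob)
    exact (summable_exp_neg_rpow hp0).tsum_ofReal_ne_top
  filter_upwards [ae_eventually_notMem hsum] with ω hω
  have hlim : Tendsto (fun n : ℕ => ENNReal.ofReal (Real.exp (-(n : ℝ) ^ p))) atTop (𝓝 0) := by
    have := ENNReal.tendsto_ofReal (summable_exp_neg_rpow hp0).tendsto_atTop_zero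
    rwa [ENNReal.ofReal_zero] at this
  refine tendsto_of_tendsto_of_tendsto_of_le_of_le' tendsto_const_nhds hlim
    (Eventually.of_forall fun _ => zero_le) ?_
  filter_upwards [hω] with n hn
  exact not_not.1 hn
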